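/- All graphs are finite, simple and undirected. Let $G=(V,E)$ be a graph and $X,Y\subseteq V$. A set $S\subseteq V$ is an $(X,Y)$-separator if $G-S$ contains no path from a vertex of $X$ to a vertex of $Y$ (the sets $X,Y,S$ may intersect); it is minimal if no proper subset of $S$ is an $(X,Y)$-separator. Let $V_{X,S}$ (respectively $V_{S,Y}$) be the set of vertices of $G-S$ reachable in $G-S$ from $X\setminus S$ (respectively from $Y\setminus S$). A minimal $(X,Y)$-separator $S$ with $|S|\le k$ is - a leftmost $(X,Y,\le k)$-separator if there is no minimal $(X,Y)$-separator $S'\ne S$ with $|S'|\le k$ and $V_{X,S'}\subseteq V_{X,S}$; - an important $(X,Y,\le k)$-separator if there is no minimal $(X,Y)$-separator $S'\neq S$ with $|S'|\le k$, $|S'|\le|S|$ and $V_{S,Y}\subsetneq V_{S',Y}$. Let $C_n$ be the $n$-th Catalan number. **Theorem.** For every integer $k\ge 1$, every graph $G=(V,E)$ and all $X,Y\subseteq V$, the number of leftmost $(X,Y,\le k)$-separators is at most $$C_{k-1}=\frac1k\binom{2(k-1)}{k-1},$$ and the number of important $(X,Y,\le k)$-separators is at most $\sum_{i=0}^{k-1}C_i$.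 Both bounds are tight for every $k\ge1$: if $G$ is the complete binary tree of depth $d\ge k+1$ (every leaf at distance $d$ from the root), $X$ is the set of its leaves and $Y$ consists of its root, then there are exactly $C_{k-1}$ leftmost and exactly $\sum_{i=0}^{k-1}C_i$ important $(X,Y,\le k)$-separators. Moreover, $C_{k-1}\sim \dfrac{4^{k-1}}{\sqrt{\pi}\,(k-1)^{3/2}}$ as $k\to\infty$. -/

import Mathlib

namespace LeftmostSep

/-- The vertices of `G - S` that can be reached in `G - S` from a vertex of `A \ S`. -/
def reach {V : Type*} (G : SimpleGraph V) (A : Set V) (S : Finset V) : Set V :=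
  {v | ∃ a ∈ A, ∃ p : G.Walk a v, ∀ w ∈ p.support, w ∉ S}

/-- `S` is an `(X, Y)`-separator: `G - S` contains no path from `X` to `Y`.
The sets `X`, `Y` and `S` may intersect. -/
def IsSeparator {V : Type*} (G : SimpleGraph V) (X Y : Set V) (S : Finset V) : Prop :=
  ∀ x ∈ X, ∀ y ∈ Y, ∀ p : G.Walk x y, ∃ w ∈ p.support, w ∈ S

/-- `S` is an inclusion-minimal `(X, Y)`-separator and has at most `k` vertices. -/
def IsMinimalSeparatorLE {V : Type*} (G : SimpleGraph V) (X Y : Set V) (k : ℕ)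
    (S : Finset V) : Prop :=
  Minimal (IsSeparator G X Y) S ∧ S.card ≤ k

/-- `S` is at least as much to the left as `S'`: `V_{X,S} ⊆ V_{X,S'}`. -/
def AtLeastAsLeft {V : Type*} (G : SimpleGraph V) (X : Set V) (S S' : Finset V) : Prop :=
  reach G X S ⊆ reach G X S'

/-- `S` is a leftmost `(X, Y, ≤ k)`-separator. -/
def IsLeftmost {V : Type*} (G : SimpleGraph V) (X Y : Set V) (k : ℕ) (S : Finset V) : Prop :=
  IsMinimalSeparatorLE G X Y k S ∧
    ¬ ∃ S', S' ≠ S ∧ IsMinimalSeparatorLE G X Y k S' ∧ AtLeastAsLeft G X S' S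

/-- `S` dominates `S'`: it is not larger, and the part of the graph on the side of `Y`
is strictly larger for `S`, that is `V_{S',Y} ⊂ V_{S,Y}`. -/
def Dominates {V : Type*} (G : SimpleGraph V) (Y : Set V) (S S' : Finset V) : Prop :=
  S.card ≤ S'.card ∧ reach G Y S' ⊂ reach G Y S

/-- `S` is an important `(X, Y, ≤ k)`-separator. -/
def IsImportant {V : Type*} (G : SimpleGraph V) (X Y : Set V) (k : ℕ) (S : Finset V) : Prop :=
  IsMinimalSeparatorLE G X Y k S ∧
    ¬ ∃ S', S' ≠ S ∧ IsMinimalSeparatorLE G X Y k S' ∧ Dominates G Y S' S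

/-- Vertices of the complete binary tree of depth `d`: words over `Bool` of length at most `d`;
the root is the empty word and the children of `l` are `false :: l` and `true :: l`. -/
abbrev BinVertex (d : ℕ) : Type := {l : List Bool // l.length ≤ d}

/-- The complete binary tree of depth `d` (every leaf has distance `d` from the root). -/
def completeBinaryTree (d : ℕ) : SimpleGraph (BinVertex d) where
  Adj u v := (∃ b, v.1 = b :: u.1) ∨ (∃ b, u.1 = b :: v.1)
  symm := ⟨fun _ _ h => h.symm⟩
  loopless := ⟨fun u h => by
    rcases h with ⟨b, hb⟩ | ⟨b, hb⟩ <;> simpa using congrArg List.length hb⟩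

/-- The root of the complete binary tree. -/
def treeRoot (d : ℕ) : BinVertex d := ⟨[], Nat.zero_le d⟩

/-- The leaves of the complete binary tree of depth `d`. -/
def treeLeaves (d : ℕ) : Set (BinVertex d) := {v | v.1.length = d}

end LeftmostSep

/-! ### Ballot numbers and Catalan asymptotics -/

namespace LeftmostSep

open Filter Topology Asymptotics PowerSeries

/-! Seen from `Y`, a minimal separator `S` is the boundary of `D = reach G Y S`, and moving `S`
towards `X` enlarges `D`. Leftmost separators thus inject into the maximal attached sets `D`
avoiding `X` with at most `k` boundary vertices (`IsLeftmost.maximal_candidate`).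

Boundary size is submodular, so if `r` is its least value, a largest set `B` attaining it lies in
every maximal `D`. Branch on a boundary vertex `v` of `B`. If `v ∈ D`, the least value becomes at
least `r + 1`; if `v ∉ D`, then `v` stays in the boundary and is paid for, so `r` and the budget
both drop by one. In terms of `r` and the slack `s = k - r` this is the recursion
`ballot_succ_succ`, and the start `r = 1` gives `ballot 1 (k - 1) = catalan (k - 1)`. Important
separators of size `j` are leftmost for the bound `j`, whence the sum.

For tightness, place each binary tree with `n` inner nodes at the root of the complete tree: its `n
+ 1` leaves form a leftmost separator, and the tree can be recovered from them. -/

/-- The ballot numbers: the coefficient of `x ^ s` in the `r`-th power of the Catalan series. It is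
the number of sequences of `r` binary trees with `s` inner nodes in total. -/
noncomputable def ballot (r s : ℕ) : ℕ := coeff s (catalanSeries ^ r)

theorem ballot_one (s : ℕ) : ballot 1 s = catalan s := by simp [ballot]

theorem ballot_zero_right (r : ℕ) : ballot r 0 = 1 := by
  simp [ballot]

/-- Compare coefficients in `C = 1 + X * C ^ 2` multiplied by `C ^ r`. The two summands match the
two branches of the counting argument. -/
theorem ballot_succ_succ (r s : ℕ) :
    ballot (r + 1) (s + 1) = ballot r (s + 1) + ballot (r + 2) s := by
  have h : catalanSeries ^ (r + 1) = catalanSeries ^ r + X * catalanSeries ^ (r + 2) := by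
    calc catalanSeries ^ (r + 1) = catalanSeries ^ r * (catalanSeries ^ 2 * X + 1) := by
          rw [catalanSeries_sq_mul_X_add_one, pow_succ]
      _ = _ := by ring
  rw [ballot, h, map_add, coeff_succ_X_mul]
  rfl

theorem ballot_succ_le {r : ℕ} (hr : 1 ≤ r) (s : ℕ) : ballot (r + 1) s ≤ ballot r (s + 1) := by
  obtain ⟨r, rfl⟩ := Nat.exists_eq_add_of_le' hr
  rw [ballot_succ_succ]
  exact Nat.le_add_left _ _

theorem one_le_ballot {r : ℕ} (hr : 1 ≤ r) (s : ℕ) : 1 ≤ ballot r s := by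
  induction s generalizing r with
  | zero => rw [ballot_zero_right]
  | succ s ih => exact (ih (by omega)).trans (ballot_succ_le hr s)

theorem one_le_catalan (n : ℕ) : 1 ≤ catalan n := by
  rw [← ballot_one]
  exact one_le_ballot le_rfl n

theorem catalan_eq_centralBinom_div_real (n : ℕ) :
    (catalan n : ℝ) = (n.centralBinom : ℝ) / (n + 1) := by
  rw [eq_div_iff (by positivity), mul_comm]
  exact_mod_cast succ_mul_catalan_eq_centralBinom n

/-- In `(2n)! / n! ^ 2` the powers of `n / e` in Stirling's normalisation cancel up to `4 ^ n`. -/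
theorem centralBinom_eq_stirlingSeq {n : ℕ} (hn : n ≠ 0) :
    (n.centralBinom : ℝ) =
      Stirling.stirlingSeq (2 * n) / Stirling.stirlingSeq n ^ 2 * (4 ^ n / √(n : ℝ)) := by
  have hn' : (0 : ℝ) < n := by positivity
  have hs : √(n : ℝ) ≠ 0 := by positivity
  have h4 : √(2 * (2 * (n : ℝ))) = 2 * √(n : ℝ) := by
    rw [← mul_assoc, Real.sqrt_mul (by norm_num), show (2 * 2 : ℝ) = 2 ^ 2 by norm_num,
      Real.sqrt_sq (by norm_num)]
  have h2 : √(2 * (n : ℝ)) ^ 2 = 2 * n := Real.sq_sqrt (by positivity)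
  have hn2 : (n : ℝ) = √(n : ℝ) ^ 2 := (Real.sq_sqrt hn'.le).symm
  have hp : (2 * (n : ℝ) / Real.exp 1) ^ (2 * n) = 4 ^ n * ((n / Real.exp 1) ^ n) ^ 2 := by
    rw [mul_div_assoc, mul_pow, pow_mul, ← pow_mul (_ / _), mul_comm n 2]
    norm_num
  have hc : (n.centralBinom : ℝ) = ((2 * n).factorial : ℝ) / (n.factorial : ℝ) ^ 2 := by
    rw [Nat.centralBinom_eq_two_mul_choose, Nat.cast_choose ℝ (by omega),
      show 2 * n - n = n by omega, sq]
  have hE : ((n : ℝ) / Real.exp 1) ^ n ≠ 0 := by positivity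
  have hf : (n.factorial : ℝ) ≠ 0 := by positivity
  rw [hc, Stirling.stirlingSeq, Stirling.stirlingSeq]
  push_cast
  rw [h4, hp]
  set E := ((n : ℝ) / Real.exp 1) ^ n
  rw [div_pow, mul_pow, h2]
  set q := √(n : ℝ)
  rw [hn2]
  field_simp

theorem catalan_isEquivalent :
    IsEquivalent atTop (fun n : ℕ => (catalan n : ℝ))
      (fun n : ℕ => (4 : ℝ) ^ n / (√Real.pi * (n : ℝ) ^ (3 / 2 : ℝ))) := by
  rw [isEquivalent_iff_tendsto_one]
  · have hs := Stirling.tendsto_stirlingSeq_sqrt_pi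
    have hpi : √Real.pi ≠ 0 := by positivity
    have h2 : Tendsto (fun n : ℕ => 2 * n) atTop atTop :=
      tendsto_id.const_mul_atTop' (by norm_num)
    have h := (((hs.comp h2).div (hs.pow 2) (by positivity)).mul_const (√Real.pi)).mul
      (tendsto_natCast_div_add_atTop (1 : ℝ))
    have e : √Real.pi / √Real.pi ^ 2 * √Real.pi * 1 = 1 := by field_simp
    rw [e] at h
    refine h.congr' ?_
    filter_upwards [eventually_ne_atTop 0] with n hn
    have hn' : (0 : ℝ) < n := by positivity
    have hpow : (n : ℝ) ^ (3 / 2 : ℝ) = n * √(n : ℝ) := by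
      rw [show (3 / 2 : ℝ) = 1 + 1 / 2 by norm_num, Real.rpow_add hn', Real.rpow_one,
        Real.sqrt_eq_rpow]
    have hq : √(n : ℝ) ≠ 0 := by positivity
    simp only [Pi.div_apply, Function.comp_apply]
    rw [catalan_eq_centralBinom_div_real, centralBinom_eq_stirlingSeq hn, hpow]
    field_simp
  · filter_upwards [eventually_ne_atTop 0] with n hn
    positivity

theorem catalan_pred_isEquivalent :
    IsEquivalent atTop (fun k : ℕ => (catalan (k - 1) : ℝ))
      (fun k : ℕ => (4 : ℝ) ^ (k - 1) / (√Real.pi * ((k : ℝ) - 1) ^ (3 / 2 : ℝ))) := by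
  refine (catalan_isEquivalent.comp_tendsto (tendsto_sub_atTop_nat 1)).congr_right ?_
  filter_upwards [eventually_ge_atTop 1] with k hk
  simp [Nat.cast_sub hk]

theorem catalan_pred_eq {k : ℕ} (hk : 1 ≤ k) :
    (catalan (k - 1) : ℝ) = 1 / (k : ℝ) * ((2 * (k - 1)).choose (k - 1) : ℝ) := by
  rw [catalan_eq_centralBinom_div_real, Nat.centralBinom_eq_two_mul_choose, Nat.cast_sub hk]
  simp [div_eq_inv_mul]

end LeftmostSep

/-! ### Boundaries of attached sets and the branching bound -/

namespace LeftmostSep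

open Finset

theorem card_sdiff_insert_add_one {V : Type*} [DecidableEq V] {A Z : Finset V} {v : V}
    (hA : v ∈ A) (hZ : v ∉ Z) :
    (A \ insert v Z).card + 1 = (A \ Z).card := by
  rw [sdiff_insert, card_erase_add_one (mem_sdiff.2 ⟨hA, hZ⟩)]

section Boundary

variable {V : Type*} [Fintype V] (G : SimpleGraph V) (Y : Set V)

open Classical in
/-- The vertices outside `D` that lie in `Y` or have a neighbour in `D`. -/
noncomputable def boundary (D : Finset V) : Finset V :=
  univ.filter fun v => v ∉ D ∧ (v ∈ Y ∨ ∃ u ∈ D, G.Adj u v)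

/-- Every vertex of `D` can be reached from `Y` inside `D`, phrased without walks: each proper
subset of `D` can be left towards a vertex of `D`. -/
def Attached (D : Finset V) : Prop :=
  ∀ A, A ⊂ D → ∃ w ∈ D, w ∈ boundary G Y A

variable {G Y}

theorem mem_boundary {D : Finset V} {v : V} :
    v ∈ boundary G Y D ↔ v ∉ D ∧ (v ∈ Y ∨ ∃ u ∈ D, G.Adj u v) := by
  simp [boundary]

theorem mem_boundary_of_subset {A B : Finset V} {v : V} (h : A ⊆ B) (hv : v ∈ boundary G Y A)
    (hvB : v ∉ B) : v ∈ boundary G Y B := by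
  rw [mem_boundary] at hv ⊢
  exact ⟨hvB, hv.2.imp_right fun ⟨u, hu, huv⟩ => ⟨u, h hu, huv⟩⟩

theorem attached_empty : Attached G Y ∅ := fun A hA => absurd hA (not_ssubset_empty A)

variable [DecidableEq V]

/-- Submodularity: the union of the two boundaries on the left lies in the union of those on the
right, and likewise for the intersections. -/
theorem card_boundary_union_add_inter_le (A B Z : Finset V) :
    (boundary G Y (A ∪ B) \ Z).card + (boundary G Y (A ∩ B) \ Z).card ≤
      (boundary G Y A \ Z).card + (boundary G Y B \ Z).card := by
  rw [← card_union_add_card_inter, ← card_union_add_card_inter (boundary G Y A \ Z)]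
  refine Nat.add_le_add (card_le_card fun v hv => ?_) (card_le_card fun v hv => ?_)
  all_goals
    simp only [mem_union, mem_inter, mem_sdiff, mem_boundary] at hv ⊢
    grind

theorem Attached.exists_mem_boundary {D A : Finset V} (hD : Attached G Y D) (h : ¬ D ⊆ A) :
    ∃ w ∈ D, w ∈ boundary G Y A := by
  obtain ⟨w, hwD, hw⟩ := hD (A ∩ D)
    ⟨inter_subset_right, fun h' => h fun x hx => (mem_inter.1 (h' hx)).1⟩
  refine ⟨w, hwD, mem_boundary_of_subset inter_subset_left hw fun hwA => ?_⟩
  exact (mem_boundary.1 hw).1 (mem_inter.2 ⟨hwA, hwD⟩)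

theorem Attached.union {D E : Finset V} (hD : Attached G Y D) (hE : Attached G Y E) :
    Attached G Y (D ∪ E) := by
  intro A hA
  by_cases h : D ⊆ A
  · obtain ⟨w, hw, hwA⟩ := hE.exists_mem_boundary fun h' => hA.2 (union_subset h h')
    exact ⟨w, mem_union_right _ hw, hwA⟩
  · obtain ⟨w, hw, hwA⟩ := hD.exists_mem_boundary h
    exact ⟨w, mem_union_left _ hw, hwA⟩

theorem Attached.insert {D : Finset V} (hD : Attached G Y D) {v : V}
    (hv : v ∈ boundary G Y D) : Attached G Y (insert v D) := by
  intro A hA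
  by_cases h : D ⊆ A
  · have hvA : v ∉ A := fun hvA => hA.2 (insert_subset hvA h)
    exact ⟨v, mem_insert_self _ _, mem_boundary_of_subset h hv hvA⟩
  · obtain ⟨w, hw, hwA⟩ := hD.exists_mem_boundary h
    exact ⟨w, mem_insert_of_mem hw, hwA⟩

/-- Intersections of attached sets need not be attached; this is the repair. For a maximal attached
`C ⊆ A`, a boundary vertex inside `A` could be added to `C`, so all of them lie outside `A`. -/
theorem Attached.exists_core {L A : Finset V} (hL : Attached G Y L) (hLA : L ⊆ A) :
    ∃ C, Attached G Y C ∧ L ⊆ C ∧ C ⊆ A ∧ boundary G Y C ⊆ boundary G Y A := by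
  obtain ⟨C, hLC, hC⟩ := (Set.toFinite {C | Attached G Y C ∧ C ⊆ A}).exists_le_maximal
    (show L ∈ {C | Attached G Y C ∧ C ⊆ A} from ⟨hL, hLA⟩)
  refine ⟨C, hC.prop.1, hLC, hC.prop.2, fun w hw => ?_⟩
  refine mem_boundary_of_subset hC.prop.2 hw fun hwA => (mem_boundary.1 hw).1 ?_
  exact hC.le_of_ge ⟨hC.prop.1.insert hw, insert_subset hwA hC.prop.2⟩ (subset_insert w C)
    (mem_insert_self w C)

variable (G Y) in
/-- The attached sets `D` with `L ⊆ D ⊆ U` that have at most `k` boundary vertices outside `Z`. -/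
def Candidate (L U Z : Finset V) (k : ℕ) (D : Finset V) : Prop :=
  Attached G Y D ∧ L ⊆ D ∧ D ⊆ U ∧ (boundary G Y D \ Z).card ≤ k

variable {L U Z : Finset V} {k r s : ℕ}

/-- A largest candidate with the least possible number of boundary vertices is contained in every
maximal candidate. -/
theorem subset_of_maximal_candidate (hL : Attached G Y L)
    (hr : ∀ k D, Candidate G Y L U Z k D → r ≤ k) {B D : Finset V}
    (hB : Candidate G Y L U Z r B) (hD : Maximal (Candidate G Y L U Z k) D) : B ⊆ D := by
  obtain ⟨hBa, hLB, hBU, hBr⟩ := hB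
  obtain ⟨hDa, hLD, hDU, hDk⟩ := hD.prop
  obtain ⟨C, hCa, hLC, hCA, hCb⟩ := hL.exists_core (subset_inter hLD hLB)
  -- The core of `D ∩ B` costs at least `r`, hence so does `D ∩ B`; submodularity then bounds the
  -- cost of `D ∪ B` by `k + r - r`.
  have h1 := hr _ C ⟨hCa, hLC, (hCA.trans inter_subset_left).trans hDU, le_rfl⟩
  have h2 := card_le_card (sdiff_subset_sdiff hCb (subset_refl Z))
  have h3 := card_boundary_union_add_inter_le (G := G) (Y := Y) D B Z
  have h4 : Candidate G Y L U Z k (D ∪ B) :=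
    ⟨hDa.union hBa, hLD.trans subset_union_left, union_subset hDU hBU, by omega⟩
  exact subset_union_right.trans (hD.le_of_ge h4 subset_union_left)

theorem maximal_candidate_mono {L' U' Z' : Finset V} {k' : ℕ} {D : Finset V}
    (h : ∀ E, Candidate G Y L' U' Z' k' E → Candidate G Y L U Z k E)
    (hD : Maximal (Candidate G Y L U Z k) D) (hD' : Candidate G Y L' U' Z' k' D) :
    Maximal (Candidate G Y L' U' Z' k') D :=
  ⟨hD', fun _ hE hle => hD.le_of_ge (h _ hE) hle⟩

/-- The branching bound: if every candidate has at least `r ≥ 1` boundary vertices outside `Z`,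
then there are at most `ballot r s` maximal ones with at most `r + s`. -/
theorem ncard_maximal_candidate_le (hr : 1 ≤ r) (hL : Attached G Y L) (hUZ : Disjoint U Z)
    (hmin : ∀ k D, Candidate G Y L U Z k D → r ≤ k) :
    {D | Maximal (Candidate G Y L U Z (r + s)) D}.ncard ≤ ballot r s := by
  -- One branch lowers `s` and raises `r`, the other lowers `r` and keeps `s`: hence `s` outside,
  -- `r` inside.
  induction s generalizing r L U Z with
  | zero =>
    rw [ballot_zero_right, Set.ncard_le_one_iff]
    intro D E hD hE
    exact (subset_of_maximal_candidate hL hmin hD.prop hE).antisymm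
      (subset_of_maximal_candidate hL hmin hE.prop hD)
  | succ s ihs =>
    induction r generalizing L U Z with
    | zero => omega
    | succ r ihr =>
    by_cases hex : ∃ B, Candidate G Y L U Z (r + 1) B
    swap
    -- The minimum is not attained, so it may be raised by one at the expense of `s`, with the same
    -- total budget.
    · refine le_trans ?_ (ballot_succ_le hr s)
      rw [show r + 1 + (s + 1) = r + 1 + 1 + s by omega]
      refine ihs (by omega) hL hUZ fun k D hD => (hmin k D hD).lt_of_ne ?_
      rintro rfl
      exact hex ⟨D, hD⟩
    obtain ⟨A, hA⟩ := hex
    obtain ⟨B, -, hB⟩ := (Set.toFinite {B | Candidate G Y L U Z (r + 1) B}).exists_le_maximal hA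
    obtain ⟨hBa, hLB, hBU, hBr⟩ := hB.prop
    have hsub : ∀ {D}, Maximal (Candidate G Y L U Z (r + 1 + (s + 1))) D → B ⊆ D :=
      subset_of_maximal_candidate hL hmin hB.prop
    by_cases hBmax : Maximal (Candidate G Y L U Z (r + 1 + (s + 1))) B
    · refine le_trans ?_ (one_le_ballot hr (s + 1))
      rw [Set.ncard_le_one_iff]
      intro D E hD hE
      rw [← hBmax.eq_of_le hD.prop (hsub hD), ← hBmax.eq_of_le hE.prop (hsub hE)]
    have hcard := hmin _ B ⟨hBa, hLB, hBU, le_rfl⟩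
    obtain ⟨v, hv⟩ := card_pos.1 (show 0 < (boundary G Y B \ Z).card by omega)
    obtain ⟨hvB, hvZ⟩ := mem_sdiff.1 hv
    have hvnB := (mem_boundary.1 hvB).1
    have hin : ∀ {k D}, Candidate G Y (insert v B) U Z k D → Candidate G Y L U Z k D :=
      fun ⟨h1, h2, h3, h4⟩ => ⟨h1, hLB.trans ((subset_insert v B).trans h2), h3, h4⟩
    -- Branch `v ∈ D`: as `B` is maximal at cost `r + 1`, every candidate containing `B` and `v`
    -- costs at least `r + 2`.
    have hM1 : {D | Maximal (Candidate G Y (insert v B) U Z (r + 1 + 1 + s)) D}.ncard ≤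
        ballot (r + 2) s := by
      refine ihs (by omega) (hBa.insert hvB) hUZ fun k D hD =>
        (hmin k D (hin hD)).lt_of_ne ?_
      rintro rfl
      obtain ⟨hvD, hBD⟩ := insert_subset_iff.1 hD.2.1
      exact hvnB (hB.le_of_ge (hin hD) hBD hvD)
    have hmem1 : ∀ {D}, Maximal (Candidate G Y L U Z (r + 1 + (s + 1))) D → v ∈ D →
        Maximal (Candidate G Y (insert v B) U Z (r + 1 + 1 + s)) D := by
      intro D hD hvD
      obtain ⟨h1, h2, h3, h4⟩ := hD.prop
      refine maximal_candidate_mono (fun E hE => ?_) hD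
        ⟨h1, insert_subset hvD (hsub hD), h3, by omega⟩
      rw [show r + 1 + (s + 1) = r + 1 + 1 + s by omega]
      exact hin hE
    -- Here `v` is the only boundary vertex of `B` outside `Z`, so a strictly larger `D` must
    -- contain it and the other branch is void.
    rcases Nat.eq_zero_or_pos r with rfl | hr0
    · refine (Set.ncard_le_ncard (Set.ofPred_subset_ofPred.2 fun D hD => hmem1 hD ?_)
        (Set.toFinite _)).trans (hM1.trans (ballot_succ_le hr s))
      have hDB : ¬ D ⊆ B := fun h => hBmax (by rwa [(hsub hD).antisymm h])
      obtain ⟨w, hwD, hwB⟩ := hD.prop.1.exists_mem_boundary hDB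
      have hwZ := disjoint_left.1 hUZ (hD.prop.2.2.1 hwD)
      rwa [card_le_one.1 hBr v hv w (mem_sdiff.2 ⟨hwB, hwZ⟩)]
    -- Branch `v ∉ D`: `v` remains in the boundary of every such `D ⊇ B`, so moving it into `Z`
    -- saves exactly one.
    have hout : ∀ {k D}, B ⊆ D → v ∉ D → ((boundary G Y D \ insert v Z).card ≤ k ↔
        (boundary G Y D \ Z).card ≤ k + 1) := by
      intro k D hBD hvD
      rw [← card_sdiff_insert_add_one (mem_boundary_of_subset hBD hvB hvD) hvZ]
      omega
    have hcand : ∀ {k D}, Candidate G Y B (U.erase v) (insert v Z) k D →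
        Candidate G Y L U Z (k + 1) D := by
      intro k D ⟨h1, h2, h3, h4⟩
      have hvD : v ∉ D := fun h => notMem_erase v U (h3 h)
      exact ⟨h1, hLB.trans h2, h3.trans (erase_subset _ _), (hout h2 hvD).1 h4⟩
    have hM2 : {D | Maximal (Candidate G Y B (U.erase v) (insert v Z) (r + (s + 1))) D}.ncard ≤
        ballot r (s + 1) := by
      refine ihr hr0 hBa ?_ fun k D hD => Nat.le_of_succ_le_succ (hmin _ D (hcand hD))
      rw [disjoint_insert_right]
      exact ⟨notMem_erase v U, hUZ.mono_left (erase_subset v U)⟩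
    rw [ballot_succ_succ]
    refine le_trans (Set.ncard_le_ncard (fun D (hD : Maximal _ D) => ?_) (Set.toFinite _))
      ((Set.ncard_union_le _ _).trans (add_le_add hM2 hM1))
    by_cases hvD : v ∈ D
    · exact Or.inr (hmem1 hD hvD)
    · obtain ⟨h1, h2, h3, h4⟩ := hD.prop
      refine Or.inl (maximal_candidate_mono (fun E hE => ?_) hD
        ⟨h1, hsub hD, subset_erase.2 ⟨h3, hvD⟩, (hout (hsub hD) hvD).2 (by omega)⟩)
      rw [show r + 1 + (s + 1) = r + (s + 1) + 1 by omega]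
      exact hcand hE

end Boundary

end LeftmostSep

/-! ### From separators to attached sets: the upper bounds -/

namespace LeftmostSep

section Separator

variable {V : Type*} {G : SimpleGraph V} {X Y : Set V} {S S' : Finset V} {k : ℕ}

theorem notMem_of_mem_reach {v : V} (hv : v ∈ reach G Y S) : v ∉ S := by
  obtain ⟨a, -, p, hp⟩ := hv
  exact hp v p.end_mem_support

theorem mem_reach_of_mem {v : V} (hv : v ∈ Y) (hS : v ∉ S) : v ∈ reach G Y S :=
  ⟨v, hv, .nil, by simpa using hS⟩

theorem mem_reach_of_adj {u v : V} (hu : u ∈ reach G Y S) (huv : G.Adj u v) (hS : v ∉ S) :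
    v ∈ reach G Y S := by
  obtain ⟨a, ha, p, hp⟩ := hu
  refine ⟨a, ha, p.concat huv, fun w hw => ?_⟩
  rw [SimpleGraph.Walk.support_concat, List.mem_append, List.mem_singleton] at hw
  rcases hw with hw | rfl
  · exact hp w hw
  · exact hS

theorem reach_subset_of_closed {A : Set V} (hY : ∀ v ∈ Y, v ∉ S → v ∈ A)
    (hA : ∀ u ∈ A, ∀ v, G.Adj u v → v ∉ S → v ∈ A) : reach G Y S ⊆ A := by
  rintro v ⟨a, ha, p, hp⟩
  have h0 : a ∈ A := hY a ha (hp a p.start_mem_support)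
  clear ha
  induction p with
  | nil => exact h0
  | cons h p ih =>
    refine ih (fun w hw => hp w (by simp [hw])) (hA _ h0 _ h (hp _ (by simp)))

theorem isSeparator_iff : IsSeparator G X Y S ↔ ∀ x ∈ X, x ∉ reach G Y S := by
  refine ⟨?_, fun h x hx y hy p => ?_⟩
  · rintro h x hx ⟨y, hy, p, hp⟩
    obtain ⟨w, hw, hwS⟩ := h x hx y hy p.reverse
    exact hp w (by simpa using hw) hwS
  · by_contra! hp
    exact h x hx ⟨y, hy, p.reverse, fun w hw => hp w (by simpa using hw)⟩

theorem IsSeparator.symm (h : IsSeparator G X Y S) : IsSeparator G Y X S := by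
  intro y hy x hx p
  simpa using h x hx y hy p.reverse

theorem isSeparator_comm : IsSeparator G X Y = IsSeparator G Y X :=
  funext fun _ => propext ⟨IsSeparator.symm, IsSeparator.symm⟩

theorem IsSeparator.notMem_reach (h : IsSeparator G X Y S) {v : V} (hX : v ∈ reach G X S) :
    v ∉ reach G Y S := by
  have hsub : reach G X S ⊆ {v | v ∉ S ∧ v ∉ reach G Y S} :=
    reach_subset_of_closed (fun x hx hxS => ⟨hxS, isSeparator_iff.1 h x hx⟩)
      fun u hu v huv hvS => ⟨hvS, fun hv => hu.2 (mem_reach_of_adj hv huv.symm hu.1)⟩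
  exact (hsub hX).2

theorem eq_empty_of_minimal (h0 : IsSeparator G X Y ∅) (hS : Minimal (IsSeparator G X Y) S) :
    S = ∅ :=
  (hS.eq_of_le h0 (Finset.empty_subset S)).symm

section Fintype

variable [Fintype V]

variable (G Y S) in
/-- `reach G Y S` as a finset. -/
noncomputable def reachFinset : Finset V := (Set.toFinite (reach G Y S)).toFinset

theorem mem_reachFinset {v : V} : v ∈ reachFinset G Y S ↔ v ∈ reach G Y S := by
  simp [reachFinset]

theorem boundary_reachFinset_subset : boundary G Y (reachFinset G Y S) ⊆ S := by
  intro w hw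
  obtain ⟨hw, h⟩ := mem_boundary.1 hw
  rw [mem_reachFinset] at hw
  by_contra hwS
  rcases h with h | ⟨u, hu, huw⟩
  · exact hw (mem_reach_of_mem h hwS)
  · exact hw (mem_reach_of_adj (mem_reachFinset.1 hu) huw hwS)

theorem attached_reachFinset : Attached G Y (reachFinset G Y S) := by
  intro A hA
  by_contra! h
  refine hA.2 fun v hv => ?_
  have hsub : reach G Y S ⊆ {v | v ∈ reach G Y S ∧ v ∈ A} := by
    refine reach_subset_of_closed (fun y hy hyS => ?_) fun u hu v huv hvS => ?_
    · have hy' : y ∈ reach G Y S := mem_reach_of_mem hy hyS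
      refine ⟨hy', by_contra fun hyA => h y (mem_reachFinset.2 hy') ?_⟩
      exact mem_boundary.2 ⟨hyA, Or.inl hy⟩
    · have hv' : v ∈ reach G Y S := mem_reach_of_adj hu.1 huv hvS
      refine ⟨hv', by_contra fun hvA => h v (mem_reachFinset.2 hv') ?_⟩
      exact mem_boundary.2 ⟨hvA, Or.inr ⟨u, hu.2, huv⟩⟩
  exact (hsub (mem_reachFinset.1 hv)).2

theorem isSeparator_boundary {D : Finset V} (hD : ∀ x ∈ X, x ∉ D) :
    IsSeparator G X Y (boundary G Y D) := by
  have hsub : reach G Y (boundary G Y D) ⊆ D := by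
    refine reach_subset_of_closed (fun y hy hyS => ?_) fun u hu v huv hvS => ?_
    · by_contra hyD
      exact hyS (mem_boundary.2 ⟨hyD, Or.inl hy⟩)
    · by_contra hvD
      exact hvS (mem_boundary.2 ⟨hvD, Or.inr ⟨u, hu, huv⟩⟩)
  exact isSeparator_iff.2 fun x hx hxr => hD x hx (hsub hxr)

/-- The boundary is itself a separator contained in `S`. Hence `S` can be recovered from its
`Y`-side. -/
theorem boundary_reachFinset (hS : Minimal (IsSeparator G X Y) S) :
    boundary G Y (reachFinset G Y S) = S := by
  refine hS.eq_of_le ?_ boundary_reachFinset_subset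
  refine isSeparator_boundary fun x hx hxr => ?_
  exact isSeparator_iff.1 hS.prop x hx (mem_reachFinset.1 hxr)

theorem eq_of_reach_eq (hS : Minimal (IsSeparator G X Y) S)
    (hS' : Minimal (IsSeparator G X Y) S') (h : reach G Y S = reach G Y S') : S = S' := by
  rw [← boundary_reachFinset hS, ← boundary_reachFinset hS']
  simp only [reachFinset, h]

/-- A vertex of `S` lies in `Y` or next to `reach G Y S`. Were it in `reach G X S'`, it would also
be in `reach G Y S'`, so `S'` would not separate. Thus `reach G X S'` avoids `S`. -/
theorem reach_subset_reach_swap (hS : Minimal (IsSeparator G X Y) S) (hS' : IsSeparator G X Y S')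
    (h : reach G Y S ⊆ reach G Y S') : reach G X S' ⊆ reach G X S := by
  have hdisj : ∀ w ∈ reach G X S', w ∉ S := by
    intro w hw hwS
    rw [← boundary_reachFinset hS, mem_boundary] at hwS
    refine hS'.notMem_reach hw ?_
    rcases hwS.2 with hwY | ⟨u, hu, huw⟩
    · exact mem_reach_of_mem hwY (notMem_of_mem_reach hw)
    · exact mem_reach_of_adj (h (mem_reachFinset.1 hu)) huw (notMem_of_mem_reach hw)
  have hsub : reach G X S' ⊆ {v | v ∈ reach G X S' ∧ v ∈ reach G X S} := by
    refine reach_subset_of_closed (fun x hx hxS => ?_) fun u hu v huv hvS => ?_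
    · have hx' : x ∈ reach G X S' := mem_reach_of_mem hx hxS
      exact ⟨hx', mem_reach_of_mem hx (hdisj x hx')⟩
    · have hv' : v ∈ reach G X S' := mem_reach_of_adj hu.1 huv hvS
      exact ⟨hv', mem_reach_of_adj hu.2 huv (hdisj v hv')⟩
  exact fun v hv => (hsub hv).2

theorem reach_subset_reach_iff (hS : Minimal (IsSeparator G X Y) S)
    (hS' : Minimal (IsSeparator G X Y) S') :
    reach G X S' ⊆ reach G X S ↔ reach G Y S ⊆ reach G Y S' := by
  refine ⟨?_, reach_subset_reach_swap hS hS'.prop⟩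
  rw [isSeparator_comm] at hS hS'
  exact reach_subset_reach_swap hS' hS.prop

variable [DecidableEq V]

theorem Attached.subset_reachFinset {D : Finset V} (hD : Attached G Y D)
    (hS : Disjoint D S) : D ⊆ reachFinset G Y S := by
  by_contra h
  obtain ⟨w, hwD, hw⟩ := hD.exists_mem_boundary h
  exact Finset.disjoint_left.1 hS hwD (boundary_reachFinset_subset hw)

open Classical in
-- For a larger candidate `D`, a minimal separator `T` inside its boundary has a `Y`-side containing
-- `D`. So `T` is at least as far left as `S`, which forces `T = S`.
theorem IsLeftmost.maximal_candidate (hS : IsLeftmost G X Y k S) :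
    Maximal (Candidate G Y ∅ (Finset.univ.filter (· ∉ X)) ∅ k) (reachFinset G Y S) := by
  obtain ⟨⟨hmin, hk⟩, hleft⟩ := hS
  refine ⟨⟨attached_reachFinset, Finset.empty_subset _, fun x hx => ?_, ?_⟩, fun D hD hle => ?_⟩
  · rw [Finset.mem_filter]
    exact ⟨Finset.mem_univ x, fun hxX =>
      isSeparator_iff.1 hmin.prop x hxX (mem_reachFinset.1 hx)⟩
  · rwa [boundary_reachFinset hmin, Finset.sdiff_empty]
  · obtain ⟨hDa, -, hDU, hDk⟩ := hD
    rw [Finset.sdiff_empty] at hDk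
    have hDX : ∀ x ∈ X, x ∉ D := fun x hx hxD => (Finset.mem_filter.1 (hDU hxD)).2 hx
    obtain ⟨T, hTD, hT⟩ := (Set.toFinite {T | IsSeparator G X Y T}).exists_le_minimal
      (isSeparator_boundary (G := G) (Y := Y) hDX)
    have hDT : D ⊆ reachFinset G Y T := by
      refine hDa.subset_reachFinset (Finset.disjoint_left.2 fun w hwD hwT => ?_)
      exact (mem_boundary.1 (hTD hwT)).1 hwD
    have hTS : T = S := by
      by_contra hne
      refine hleft ⟨T, hne, ⟨hT, (Finset.card_le_card hTD).trans hDk⟩, ?_⟩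
      refine (reach_subset_reach_iff hmin hT).2 fun v hv => ?_
      exact mem_reachFinset.1 (hDT (hle (mem_reachFinset.2 hv)))
    rwa [hTS] at hDT

end Fintype

variable [Finite V]

theorem ncard_isLeftmost_le (hk : 1 ≤ k) (G : SimpleGraph V) (X Y : Set V) :
    {S : Finset V | IsLeftmost G X Y k S}.ncard ≤ catalan (k - 1) := by
  classical
  have := Fintype.ofFinite V
  by_cases h0 : IsSeparator G X Y ∅
  · refine le_trans ?_ (one_le_catalan _)
    rw [Set.ncard_le_one_iff]
    intro S T hS hT
    rw [eq_empty_of_minimal h0 hS.1.1, eq_empty_of_minimal h0 hT.1.1]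
  rw [← ballot_one]
  -- Since `∅` does not separate, every boundary is nonempty: start with `r = 1`, `s = k - 1`.
  refine le_trans ?_ (ncard_maximal_candidate_le (G := G) (Y := Y) (L := ∅)
    (U := Finset.univ.filter (· ∉ X)) (Z := ∅) le_rfl attached_empty
    (Finset.disjoint_empty_right _) fun j D hD => ?_)
  · rw [Nat.add_sub_cancel' hk]
    refine Set.ncard_le_ncard_of_injOn (fun S => reachFinset G Y S)
      (fun S hS => IsLeftmost.maximal_candidate hS) (fun S hS T hT h => ?_) (Set.toFinite _)
    simp only at h
    rw [← boundary_reachFinset hS.1.1, h, boundary_reachFinset hT.1.1]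
  · rw [Nat.one_le_iff_ne_zero]
    rintro rfl
    apply h0
    have hb := hD.2.2.2
    rw [Finset.sdiff_empty, Nat.le_zero, Finset.card_eq_zero] at hb
    rw [← hb]
    exact isSeparator_boundary fun x hx hxD => (Finset.mem_filter.1 (hD.2.2.1 hxD)).2 hx

/-- The important separators of size `j` are the leftmost separators for the bound `j` of
size `j`. -/
theorem isImportant_iff : IsImportant G X Y k S ↔ IsLeftmost G X Y S.card S ∧ S.card ≤ k := by
  have := Fintype.ofFinite V
  constructor
  · rintro ⟨⟨hmin, hk⟩, h⟩
    refine ⟨⟨⟨hmin, le_rfl⟩, fun ⟨T, hne, ⟨hT, hTS⟩, hle⟩ => ?_⟩, hk⟩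
    have hsub := (reach_subset_reach_iff hmin hT).1 hle
    refine h ⟨T, hne, ⟨hT, hTS.trans hk⟩, hTS, hsub.ssubset_of_ne fun heq => ?_⟩
    exact hne (eq_of_reach_eq hmin hT heq).symm
  · rintro ⟨⟨⟨hmin, -⟩, h⟩, hk⟩
    refine ⟨⟨hmin, hk⟩, fun ⟨T, hne, ⟨hT, _⟩, hTS, hlt⟩ => ?_⟩
    exact h ⟨T, hne, ⟨hT, hTS⟩, (reach_subset_reach_iff hmin hT).2 hlt.subset⟩

theorem ncard_isImportant_le (hk : 1 ≤ k) (G : SimpleGraph V) (X Y : Set V) :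
    {S : Finset V | IsImportant G X Y k S}.ncard ≤ ∑ i ∈ Finset.range k, catalan i := by
  by_cases h0 : IsSeparator G X Y ∅
  · have h1 : 1 ≤ ∑ i ∈ Finset.range k, catalan i :=
      (one_le_catalan 0).trans (Finset.single_le_sum (f := catalan) (fun _ _ => Nat.zero_le _)
        (Finset.mem_range.2 hk))
    refine le_trans ?_ h1
    rw [Set.ncard_le_one_iff]
    intro S T hS hT
    rw [eq_empty_of_minimal h0 hS.1.1, eq_empty_of_minimal h0 hT.1.1]
  · have hsub : {S : Finset V | IsImportant G X Y k S} ⊆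
        ⋃ i ∈ Finset.range k, {S : Finset V | IsLeftmost G X Y (i + 1) S} := by
      intro S hS
      obtain ⟨hl, hc⟩ := isImportant_iff.1 hS
      have hpos : S.card ≠ 0 := fun h => h0 (Finset.card_eq_zero.1 h ▸ hS.1.1.prop)
      simp only [Set.mem_iUnion, Finset.mem_range]
      refine ⟨S.card - 1, by omega, ?_⟩
      rw [Nat.sub_add_cancel (by omega)]
      exact hl
    refine (Set.ncard_le_ncard hsub (Set.toFinite _)).trans
      ((Finset.set_ncard_biUnion_le _ _).trans (Finset.sum_le_sum fun i _ => ?_))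
    exact ncard_isLeftmost_le (Nat.le_add_left 1 i) G X Y

/-- The important separators contain the leftmost separators that exhaust some smaller bound. -/
theorem sum_le_ncard_isImportant {f : ℕ → ℕ}
    (hf : ∀ i < k, f i ≤ {S : Finset V | IsLeftmost G X Y (i + 1) S ∧ S.card = i + 1}.ncard) :
    ∑ i ∈ Finset.range k, f i ≤ {S : Finset V | IsImportant G X Y k S}.ncard := by
  induction k with
  | zero => simp
  | succ k ih =>
    rw [Finset.sum_range_succ]
    refine (add_le_add (ih fun i hi => hf i (by omega)) (hf k (by omega))).trans ?_
    rw [← Set.ncard_union_eq _ (Set.toFinite _) (Set.toFinite _)]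
    · refine Set.ncard_le_ncard ?_ (Set.toFinite _)
      rintro S (hS | ⟨hS, hc⟩)
      · obtain ⟨h1, h2⟩ := isImportant_iff.1 hS
        exact isImportant_iff.2 ⟨h1, by omega⟩
      · exact isImportant_iff.2 ⟨hc ▸ hS, hc.le⟩
    · rw [Set.disjoint_left]
      rintro S hS ⟨-, hc⟩
      have := hS.1.2
      omega

end Separator

end LeftmostSep

/-! ### Leaf sets of binary trees -/

namespace LeftmostSep

section BinaryTree

/-- The leaves of the binary tree `t` placed with its root at the word `w`. -/
def leafSet : BinaryTree Unit → List Bool → Finset (List Bool)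
  | .nil, w => {w}
  | .node _ l r, w => leafSet l (false :: w) ∪ leafSet r (true :: w)

/-- Words grow at the head, so `w <:+ x` means that `w` is an ancestor of `x` or `x` itself. -/
theorem suffix_of_mem_leafSet {t : BinaryTree Unit} {w x : List Bool} (h : x ∈ leafSet t w) :
    w <:+ x := by
  induction t generalizing w with
  | nil => simp_all [leafSet]
  | node _ l r ihl ihr =>
    rw [leafSet, Finset.mem_union] at h
    rcases h with h | h
    · exact (List.suffix_cons _ _).trans (ihl h)
    · exact (List.suffix_cons _ _).trans (ihr h)

theorem length_le_of_mem_leafSet {t : BinaryTree Unit} {w x : List Bool} (h : x ∈ leafSet t w) :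
    x.length ≤ w.length + t.numNodes := by
  induction t generalizing w with
  | nil => simp_all [leafSet]
  | node _ l r ihl ihr =>
    rw [leafSet, Finset.mem_union] at h
    rw [BinaryTree.numNodes]
    rcases h with h | h
    · have := ihl h
      rw [List.length_cons] at this
      omega
    · have := ihr h
      rw [List.length_cons] at this
      omega

theorem exists_mem_leafSet_suffix {t : BinaryTree Unit} {w x : List Bool} (hw : w <:+ x)
    (hx : w.length + t.numNodes ≤ x.length) : ∃ s ∈ leafSet t w, s <:+ x := by
  induction t generalizing w with
  | nil => exact ⟨w, by simp [leafSet], hw⟩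
  | node _ l r ihl ihr =>
    rw [BinaryTree.numNodes] at hx
    obtain ⟨p, rfl⟩ := hw
    rcases List.eq_nil_or_concat p with rfl | ⟨q, b, rfl⟩
    · simp at hx
    · have hb : b :: w <:+ q.concat b ++ w := ⟨q, by simp⟩
      cases b with
      | false =>
        obtain ⟨s, hs, h⟩ := ihl hb (by rw [List.length_cons]; omega)
        exact ⟨s, Finset.mem_union_left _ hs, h⟩
      | true =>
        obtain ⟨s, hs, h⟩ := ihr hb (by rw [List.length_cons]; omega)
        exact ⟨s, Finset.mem_union_right _ hs, h⟩

theorem eq_of_cons_suffix_cons_suffix {b c : Bool} {w x : List Bool} (hb : b :: w <:+ x)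
    (hc : c :: w <:+ x) : b = c := by
  have := (List.suffix_of_suffix_length_le hb hc (by simp)).eq_of_length (by simp)
  exact (List.cons.inj this).1

theorem leafSet_antichain {t : BinaryTree Unit} {w x y : List Bool} (hx : x ∈ leafSet t w)
    (hy : y ∈ leafSet t w) (h : x <:+ y) : x = y := by
  induction t generalizing w with
  | nil => simp_all [leafSet]
  | node _ l r ihl ihr =>
    rw [leafSet, Finset.mem_union] at hx hy
    rcases hx with hx | hx <;> rcases hy with hy | hy
    · exact ihl hx hy
    · have := eq_of_cons_suffix_cons_suffix ((suffix_of_mem_leafSet hx).trans h)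
        (suffix_of_mem_leafSet hy)
      simp at this
    · have := eq_of_cons_suffix_cons_suffix ((suffix_of_mem_leafSet hx).trans h)
        (suffix_of_mem_leafSet hy)
      simp at this
    · exact ihr hx hy

theorem card_leafSet (t : BinaryTree Unit) (w : List Bool) :
    (leafSet t w).card = t.numNodes + 1 := by
  induction t generalizing w with
  | nil => simp [leafSet]
  | node _ l r ihl ihr =>
    rw [leafSet, Finset.card_union_of_disjoint, ihl, ihr, BinaryTree.numNodes]
    · omega
    · refine Finset.disjoint_left.2 fun x hx hy => ?_
      have := eq_of_cons_suffix_cons_suffix (suffix_of_mem_leafSet hx) (suffix_of_mem_leafSet hy)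
      simp at this

theorem mem_leafSet_node_false {u : Unit} {l r : BinaryTree Unit} {w x : List Bool} :
    x ∈ leafSet l (false :: w) ↔ x ∈ leafSet (.node u l r) w ∧ false :: w <:+ x := by
  rw [leafSet, Finset.mem_union]
  refine ⟨fun h => ⟨Or.inl h, suffix_of_mem_leafSet h⟩, fun ⟨h, hs⟩ => h.resolve_right fun h => ?_⟩
  have := eq_of_cons_suffix_cons_suffix (suffix_of_mem_leafSet h) hs
  simp at this

theorem mem_leafSet_node_true {u : Unit} {l r : BinaryTree Unit} {w x : List Bool} :
    x ∈ leafSet r (true :: w) ↔ x ∈ leafSet (.node u l r) w ∧ true :: w <:+ x := by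
  rw [leafSet, Finset.mem_union]
  refine ⟨fun h => ⟨Or.inr h, suffix_of_mem_leafSet h⟩, fun ⟨h, hs⟩ => h.resolve_left fun h => ?_⟩
  have := eq_of_cons_suffix_cons_suffix (suffix_of_mem_leafSet h) hs
  simp at this

/-- Cardinality tells `nil` from `node`; the leaves below each child of `w` determine the
corresponding subtree. -/
theorem leafSet_injective (w : List Bool) : Function.Injective fun t => leafSet t w := by
  intro t t' h
  induction t generalizing w t' with
  | nil =>
    have hc := congrArg Finset.card h
    simp only [card_leafSet] at hc
    cases t' with
    | nil => rfl
    | node => simp [BinaryTree.numNodes] at hc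
  | node u l r ihl ihr =>
    cases t' with
    | nil =>
      have hc := congrArg Finset.card h
      simp [card_leafSet, BinaryTree.numNodes] at hc
    | node u' l' r' =>
      simp only at h
      congr 1
      · refine ihl (false :: w) (Finset.ext fun x => ?_)
        simp only
        rw [mem_leafSet_node_false (u := u) (r := r), h, ← mem_leafSet_node_false]
      · refine ihr (true :: w) (Finset.ext fun x => ?_)
        simp only
        rw [mem_leafSet_node_true (u := u) (l := l), h, ← mem_leafSet_node_true]

end BinaryTree

/-! ### Tightness on the complete binary tree -/

section CompleteBinaryTree

variable {d : ℕ}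

instance (d : ℕ) : Finite (BinVertex d) := (List.finite_length_le Bool d).to_subtype

theorem mem_reach_treeRoot {S : Finset (BinVertex d)} {v : BinVertex d} :
    v ∈ reach (completeBinaryTree d) {treeRoot d} S ↔ ∀ s ∈ S, ¬ s.1 <:+ v.1 := by
  constructor
  · intro hv
    have hsub : reach (completeBinaryTree d) {treeRoot d} S ⊆
        {v | ∀ s ∈ S, ¬ s.1 <:+ v.1} := by
      refine reach_subset_of_closed ?_ ?_
      · rintro v rfl hv s hs h
        have : s = treeRoot d := Subtype.ext (List.suffix_nil.1 h)
        exact hv (this ▸ hs)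
      · rintro u hu v (⟨b, hb⟩ | ⟨b, hb⟩) hvS s hs h
        · rw [hb, List.suffix_cons_iff, ← hb] at h
          rcases h with h | h
          · exact hvS (Subtype.ext h ▸ hs)
          · exact hu s hs h
        · exact hu s hs (h.trans (hb ▸ List.suffix_cons _ _))
    exact hsub hv
  · obtain ⟨l, hl⟩ := v
    induction l with
    | nil => exact fun h => mem_reach_of_mem rfl fun hS => h _ hS (List.suffix_refl _)
    | cons b l ih =>
      intro h
      have hl' : l.length ≤ d := by simp at hl; omega
      refine mem_reach_of_adj (ih hl' fun s hs hsl => h s hs (hsl.trans (List.suffix_cons _ _)))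
        (Or.inl ⟨b, rfl⟩) fun hS => h _ hS (List.suffix_refl _)

theorem isSeparator_treeLeaves {S : Finset (BinVertex d)} :
    IsSeparator (completeBinaryTree d) (treeLeaves d) {treeRoot d} S ↔
      ∀ x : BinVertex d, x.1.length = d → ∃ s ∈ S, s.1 <:+ x.1 := by
  rw [isSeparator_iff]
  refine forall₂_congr fun x _ => ?_
  rw [mem_reach_treeRoot]
  push Not
  rfl

theorem exists_leaf_suffix {w : List Bool} (hw : w.length ≤ d) :
    ∃ x : BinVertex d, x.1.length = d ∧ w <:+ x.1 :=
  have h : (List.replicate (d - w.length) false ++ w).length = d := by simp; omega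
  ⟨⟨_, h.le⟩, h, List.suffix_append _ _⟩

/-- An antichain of inner vertices that separates the leaves from the root is leftmost among the
separators that are not larger. -/
theorem isLeftmost_of_antichain {S : Finset (BinVertex d)}
    (hsep : IsSeparator (completeBinaryTree d) (treeLeaves d) {treeRoot d} S)
    (hanti : ∀ s ∈ S, ∀ t ∈ S, s.1 <:+ t.1 → s = t) (hinner : ∀ s ∈ S, s.1.length < d) :
    IsLeftmost (completeBinaryTree d) (treeLeaves d) {treeRoot d} S.card S := by
  -- Ancestors of one word form a chain, so distinct members of `S` have no common descendant.
  have hcomp : ∀ s ∈ S, ∀ t ∈ S, ∀ x : List Bool, s.1 <:+ x → t.1 <:+ x → s = t := by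
    intro s hs t ht x hsx htx
    rcases List.suffix_or_suffix_of_suffix hsx htx with h | h
    · exact hanti s hs t ht h
    · exact (hanti t ht s hs h).symm
  have hmin : Minimal
      (IsSeparator (completeBinaryTree d) (treeLeaves d) {treeRoot d}) S := by
    refine ⟨hsep, fun T hT hTS s hs => ?_⟩
    obtain ⟨x, hx, hsx⟩ := exists_leaf_suffix s.2
    obtain ⟨t, ht, htx⟩ := isSeparator_treeLeaves.1 hT x hx
    rwa [hcomp s hs t (hTS ht) _ hsx htx]
  refine ⟨⟨hmin, le_rfl⟩, ?_⟩
  rintro ⟨T, hne, ⟨hT, hTc⟩, hle⟩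
  have := Fintype.ofFinite (BinVertex d)
  have hsub := (reach_subset_reach_iff hmin hT).1 hle
  have hbelow : ∀ s ∈ S, ∀ x : BinVertex d, x.1.length = d → s.1 <:+ x.1 →
      ∃ t ∈ T, s.1 <:+ t.1 ∧ t.1 <:+ x.1 := by
    intro s hs x hx hsx
    obtain ⟨t, ht, htx⟩ := isSeparator_treeLeaves.1 hT.prop x hx
    refine ⟨t, ht, ?_, htx⟩
    rcases List.suffix_or_suffix_of_suffix hsx htx with h | h
    · exact h
    by_contra hst
    -- A `t` strictly above `s` has no member of `S` above or at it, so the root reaches it in `G -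
    -- S`, hence in `G - T`, although `t ∈ T`.
    refine notMem_of_mem_reach (hsub (mem_reach_treeRoot.2 fun s' hs' hs't => ?_)) ht
    exact hst (hanti s' hs' s hs (hs't.trans h) ▸ hs't)
  have hex : ∀ s : BinVertex d, ∃ t, s ∈ S → t ∈ T ∧ s.1 <:+ t.1 := by
    intro s
    by_cases hs : s ∈ S
    · obtain ⟨x, hx, hsx⟩ := exists_leaf_suffix s.2
      obtain ⟨t, ht, hst, -⟩ := hbelow s hs x hx hsx
      exact ⟨t, fun _ => ⟨ht, hst⟩⟩
    · exact ⟨s, fun h => absurd h hs⟩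
  choose f hf using hex
  have hinj : Set.InjOn f S := fun s hs s' hs' h =>
    hcomp s hs s' hs' (f s).1 (hf s hs).2 (h ▸ (hf s' hs').2)
  -- As `T` is not larger than `S`, exactly one member of `T` lies at or below each `s ∈ S`.
  have hsurj : Set.SurjOn f S T :=
    Finset.surjOn_of_injOn_of_card_le f (fun s hs => (hf s hs).1) hinj hTc
  have huniq : ∀ s ∈ S, ∀ t ∈ T, s.1 <:+ t.1 → t = f s := by
    intro s hs t ht hst
    obtain ⟨s', hs', rfl⟩ := hsurj ht
    rw [hcomp s hs s' hs' _ hst (hf s' hs').2]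
  have hfix : ∀ s ∈ S, f s = s := by
    intro s hs
    obtain ⟨hfT, hfs⟩ := hf s hs
    by_contra hne
    -- If `f s` is below the child `b` of `s`, a leaf under the other child, which exists as `s` is
    -- inner, needs a second member of `T` below `s`.
    have hbit : ∃ b, b :: s.1 <:+ (f s).1 := by
      obtain ⟨p, hp⟩ := hfs
      rcases List.eq_nil_or_concat p with rfl | ⟨q, b, rfl⟩
      · exact absurd (Subtype.ext hp.symm) hne
      · exact ⟨b, q, by simpa using hp⟩
    obtain ⟨b, hb⟩ := hbit
    obtain ⟨x, hx, hbx⟩ := exists_leaf_suffix (d := d) (w := (!b) :: s.1)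
      (by rw [List.length_cons]; exact hinner s hs)
    obtain ⟨t, ht, hst, htx⟩ := hbelow s hs x hx ((List.suffix_cons _ _).trans hbx)
    rw [huniq s hs t ht hst] at htx
    have := eq_of_cons_suffix_cons_suffix (hb.trans htx) hbx
    cases b <;> simp at this
  refine hne (Finset.Subset.antisymm (fun t ht => ?_) fun s hs => ?_)
  · obtain ⟨s, hs, rfl⟩ := hsurj ht
    rwa [hfix s hs]
  · rw [← hfix s hs]
    exact (hf s hs).1

/-- The leaves of the binary tree `t` as vertices of the complete binary tree of depth `d`. -/
def leafVertices (d : ℕ) (t : BinaryTree Unit) : Finset (BinVertex d) :=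
  (leafSet t []).subtype fun l => l.length ≤ d

theorem mem_leafVertices {t : BinaryTree Unit} {v : BinVertex d} :
    v ∈ leafVertices d t ↔ v.1 ∈ leafSet t [] :=
  Finset.mem_subtype

theorem map_leafVertices {t : BinaryTree Unit} (ht : t.numNodes ≤ d) :
    (leafVertices d t).map (Function.Embedding.subtype _) = leafSet t [] := by
  refine Finset.subtype_map_of_mem fun x hx => ?_
  have := length_le_of_mem_leafSet hx
  simp at this
  omega

theorem card_leafVertices {t : BinaryTree Unit} (ht : t.numNodes ≤ d) :
    (leafVertices d t).card = t.numNodes + 1 := by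
  rw [← card_leafSet t [], ← map_leafVertices ht, Finset.card_map]

theorem isLeftmost_leafVertices {t : BinaryTree Unit} (ht : t.numNodes < d) :
    IsLeftmost (completeBinaryTree d) (treeLeaves d) {treeRoot d} (t.numNodes + 1)
      (leafVertices d t) := by
  rw [← card_leafVertices ht.le]
  refine isLeftmost_of_antichain (isSeparator_treeLeaves.2 fun x hx => ?_) ?_ fun s hs => ?_
  · obtain ⟨s, hs, hsx⟩ := exists_mem_leafSet_suffix (t := t) (List.nil_suffix (l := x.1))
      (by simp; omega)
    exact ⟨⟨s, hsx.length_le.trans x.2⟩, mem_leafVertices.2 hs, hsx⟩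
  · intro s hs s' hs' h
    exact Subtype.ext (leafSet_antichain (mem_leafVertices.1 hs) (mem_leafVertices.1 hs') h)
  · have := length_le_of_mem_leafSet (mem_leafVertices.1 hs)
    simp at this
    omega

theorem catalan_le_ncard_isLeftmost {n : ℕ} (hn : n < d) :
    catalan n ≤ {S | IsLeftmost (completeBinaryTree d) (treeLeaves d) {treeRoot d} (n + 1) S ∧
      S.card = n + 1}.ncard := by
  rw [← BinaryTree.treesOfNumNodesEq_card_eq_catalan, ← Set.ncard_coe_finset]
  refine Set.ncard_le_ncard_of_injOn (leafVertices d) (fun t ht => ?_) (fun t ht t' ht' h => ?_)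
    (Set.toFinite _)
  · have ht' : t.numNodes = n := BinaryTree.mem_treesOfNumNodesEq.1 ht
    subst ht'
    exact ⟨isLeftmost_leafVertices hn, card_leafVertices hn.le⟩
  · have e : t.numNodes = n := BinaryTree.mem_treesOfNumNodesEq.1 ht
    have e' : t'.numNodes = n := BinaryTree.mem_treesOfNumNodesEq.1 ht'
    apply leafSet_injective []
    simp only
    rw [← map_leafVertices (d := d) (by omega), h, map_leafVertices (by omega)]

end CompleteBinaryTree

end LeftmostSep

theorem mainTheorem1 :
    (∀ k : ℕ, 1 ≤ k →
      (∀ (V : Type*) [Finite V] (G : SimpleGraph V) (X Y : Set V),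
        {S : Finset V | LeftmostSep.IsLeftmost G X Y k S}.ncard ≤ catalan (k - 1) ∧
        {S : Finset V | LeftmostSep.IsImportant G X Y k S}.ncard
          ≤ ∑ i ∈ Finset.range k, catalan i) ∧
      (∀ d : ℕ, k + 1 ≤ d →
        {S | LeftmostSep.IsLeftmost (LeftmostSep.completeBinaryTree d)
          (LeftmostSep.treeLeaves d) {LeftmostSep.treeRoot d} k S}.ncard = catalan (k - 1) ∧
        {S | LeftmostSep.IsImportant (LeftmostSep.completeBinaryTree d)
          (LeftmostSep.treeLeaves d) {LeftmostSep.treeRoot d} k S}.ncard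
          = ∑ i ∈ Finset.range k, catalan i) ∧
      (catalan (k - 1) : ℝ) = 1 / (k : ℝ) * ((2 * (k - 1)).choose (k - 1) : ℝ)) ∧
    Asymptotics.IsEquivalent Filter.atTop (fun k : ℕ => (catalan (k - 1) : ℝ))
      (fun k : ℕ => (4 : ℝ) ^ (k - 1) / (√Real.pi * ((k : ℝ) - 1) ^ (3 / 2 : ℝ))) := by
  refine ⟨fun k hk => ⟨fun V _ G X Y => ⟨LeftmostSep.ncard_isLeftmost_le hk G X Y,
    LeftmostSep.ncard_isImportant_le hk G X Y⟩, fun d hd => ⟨?_, ?_⟩,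
    LeftmostSep.catalan_pred_eq hk⟩, LeftmostSep.catalan_pred_isEquivalent⟩
  · refine le_antisymm (LeftmostSep.ncard_isLeftmost_le hk _ _ _) ?_
    refine (LeftmostSep.catalan_le_ncard_isLeftmost (d := d) (by omega)).trans
      (Set.ncard_le_ncard (fun S hS => ?_) (Set.toFinite _))
    rw [Nat.sub_add_cancel hk] at hS
    exact hS.1
  · refine le_antisymm (LeftmostSep.ncard_isImportant_le hk _ _ _) ?_
    exact LeftmostSep.sum_le_ncard_isImportant fun i hi =>
      LeftmostSep.catalan_le_ncard_isLeftmost (by omega)
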